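/- Let $X_1,X_2,\ldots$ and $Y_1,Y_2,\ldots$ be two independent sequences of i.i.d. random letters from a finite alphabet $\mathbb{A}$, all having the same distribution. Let $S:\mathbb{A}\times\mathbb{A}\to[0,\infty)$ be a symmetric pairwise scoring function, and put $$F=\max_{a,b\in\mathbb{A}}S(a,b),\qquad A=\max_{a,b,c\in\mathbb{A}}|S(a,b)-S(a,c)| .$$ Let $\delta\le F$ be a real number, the gap price (it may be negative). An alignment of two sequences of length $n$ is a pair $(\pi,\mu)$ of strictly increasing sequences $1\le\pi_1<\cdots<\pi_k\le n$ and $1\le\mu_1<\cdots<\mu_k\le n$ of the same length $k$, $0\le k\le n$. Its score is $\sum_{i=1}^kS(X_{\pi_i},Y_{\mu_i})+\delta(n-k)$. Let $L_n$ be the maximum of the scores of all alignments of $(X_1,\ldots,X_n)$ and $(Y_1,\ldots,Y_n)$, and let $l_n=E L_n/n$. Then the limit $l=\lim_{n\to\infty}l_n$ exists in $\mathbb{R}$, and for every even integer $n\ge2$ and every $c>A$, $$l-l_n\le c\,\sqrt{\frac{2}{n-1}\left(\frac{n+1}{n-1}+\ln(n-1)\right)}+\frac{F}{n-1}.$$ 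-/

import Mathlib

open MeasureTheory ProbabilityTheory Filter Topology

noncomputable section

namespace SequenceComparison

/-- An alignment of two sequences of length `n`: two strictly increasing sequences
`π₁ < ⋯ < π_k` and `μ₁ < ⋯ < μ_k` of the same length `k` of positions
(positions are numbered from `0` to `n - 1`). -/
structure Alignment (n : ℕ) where
  /-- the number of aligned letters -/
  k : ℕ
  /-- the aligned positions in the first sequence -/
  fst : Fin k → Fin n
  /-- the aligned positions in the second sequence -/
  snd : Fin k → Fin n
  fst_strictMono : StrictMono fst
  snd_strictMono : StrictMono snd

theorem Alignment.k_le {n : ℕ} (a : Alignment n) : a.k ≤ n := by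
  simpa using Fintype.card_le_of_injective a.fst a.fst_strictMono.injective

/-- The alignment that aligns no letters. -/
def Alignment.empty (n : ℕ) : Alignment n where
  k := 0
  fst := Fin.elim0
  snd := Fin.elim0
  fst_strictMono := fun i => Fin.elim0 i
  snd_strictMono := fun i => Fin.elim0 i

instance (n : ℕ) : Nonempty (Alignment n) := ⟨Alignment.empty n⟩

instance (n : ℕ) : Finite (Alignment n) := by
  let f : Alignment n → Σ k : Fin (n + 1), (Fin k → Fin n) × (Fin k → Fin n) :=
    fun a => ⟨⟨a.k, Nat.lt_succ_of_le a.k_le⟩, a.fst, a.snd⟩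
  refine Finite.of_injective f ?_
  rintro ⟨k, p, q, hp, hq⟩ ⟨k', p', q', hp', hq'⟩ h
  simp only [f, Sigma.mk.injEq, Fin.mk.injEq] at h
  obtain ⟨rfl, h⟩ := h
  simp only [heq_eq_eq, Prod.mk.injEq] at h
  obtain ⟨rfl, rfl⟩ := h
  rfl

variable {𝔸 : Type*}

/-- The score `∑ i, S(x_{π_i}, y_{μ_i}) + δ (n - k)` of an alignment with `n - k` gaps. -/
def alignmentScore (S : 𝔸 → 𝔸 → ℝ) (δ : ℝ) {n : ℕ} (x y : Fin n → 𝔸) (a : Alignment n) : ℝ :=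
  ∑ i : Fin a.k, S (x (a.fst i)) (y (a.snd i)) + δ * ((n : ℝ) - (a.k : ℝ))

/-- The optimal score: the maximum of the scores of all alignments. -/
def optimalScore (S : 𝔸 → 𝔸 → ℝ) (δ : ℝ) {n : ℕ} (x y : Fin n → 𝔸) : ℝ :=
  ⨆ a : Alignment n, alignmentScore S δ x y a

/-- The supremum in the definition of the optimal score is a maximum. -/
theorem isGreatest_optimalScore (S : 𝔸 → 𝔸 → ℝ) (δ : ℝ) {n : ℕ} (x y : Fin n → 𝔸) :
    IsGreatest (Set.range (alignmentScore S δ x y)) (optimalScore S δ x y) := by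
  refine ⟨(Set.range_nonempty _).csSup_mem (Set.finite_range _), ?_⟩
  rintro _ ⟨a, rfl⟩
  exact le_ciSup (Set.finite_range (alignmentScore S δ x y)).bddAbove a

/-- `F`, the largest score of a pair of letters. -/
def maxLetterScore [Fintype 𝔸] [Nonempty 𝔸] (S : 𝔸 → 𝔸 → ℝ) : ℝ :=
  Finset.univ.sup' Finset.univ_nonempty fun p : 𝔸 × 𝔸 => S p.1 p.2

/-- `A`, the largest change of the pairwise score when one letter is changed
(for symmetric `S` it does not matter which of the two letters is changed). -/
def maxScoreChange [Fintype 𝔸] [Nonempty 𝔸] (S : 𝔸 → 𝔸 → ℝ) : ℝ :=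
  Finset.univ.sup' Finset.univ_nonempty
    fun p : 𝔸 × 𝔸 × 𝔸 => |S p.1 p.2.1 - S p.1 p.2.2|

/-- `l_n = E L_n / n`, where `L_n` is the optimal score of the first `n` letters
of the two random sequences. -/
def meanScore {Ω : Type*} [MeasurableSpace Ω] (P : Measure Ω) (S : 𝔸 → 𝔸 → ℝ) (δ : ℝ)
    (X Y : ℕ → Ω → 𝔸) (n : ℕ) : ℝ :=
  (∫ ω, optimalScore S δ (fun i : Fin n => X i ω) (fun i : Fin n => Y i ω) ∂P) / (n : ℝ)

end SequenceComparison

end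

noncomputable section

namespace SequenceComparison

/-! ### Exponential moments of functions with bounded differences -/

section BoundedDifferences

/-! Write `u n` for the mean optimal score. Replacing `S` by `w = S - δ` turns the score into the
weight of a set of pairs plus a gap term linear in the side lengths of the box. Joining aligned sets
corner to corner makes `u` superadditive, so `u n / n` converges by Fekete's lemma.

For the rate, an optimal alignment in the `N × N` square is cut into `m` boxes, each with increments
of combined length `n - 1` or `n`, where `2 * N ≤ m * (n - 1)` (`exists_boxScore_le_cutScore`). An
`i × j` box with `i + j ≤ n` has mean score at most `u n / 2`: glued to its mirror image it fits
into an `n × n` square (`two_mul_meanBoxScore_le`). Hence each fixed cut has mean score at most `m *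
u n / 2`.

The optimal score is at most a maximum over at most `(2n + 1) ^ m` cuts. Each cut score changes by
at most `A` when one of the `2N` letters changes, so McDiarmid's exponential bound and a union bound
over the cuts give `mul_meanBoxScore_le`. Taking `N = q(n - 1)`, `m = 2q`, choosing the exponential
parameter and letting `q → ∞` bounds the limit by `u n / (n - 1)` plus the square-root term; passing
from `n - 1` to `n` in the denominator costs `F / (n - 1)`. -/

theorem DependsOn.comp_left {ι 𝔸 β γ : Type*} {f : (ι → 𝔸) → β} {s : Set ι} (hf : DependsOn f s)
    (g : β → γ) : DependsOn (fun x => g (f x)) s :=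
  fun _ _ h => congrArg g (hf h)

/-- For i.i.d. families, the mean of a function is unchanged by an injective reindexing. -/
theorem integral_reindex {ι 𝔸 Ω : Type*} [MeasurableSpace 𝔸] [MeasurableSpace Ω] {P : Measure Ω}
    {ξ : ι → Ω → 𝔸} {μ : Measure 𝔸} (hξ : ∀ i, Measurable (ξ i)) (hind : iIndepFun ξ P)
    (hlaw : ∀ i, P.map (ξ i) = μ) {f : (ι → 𝔸) → ℝ} (hf : Measurable f) {τ : ι → ι}
    (hτ : τ.Injective) :
    ∫ ω, f (fun i => ξ (τ i) ω) ∂P = ∫ ω, f (fun i => ξ i ω) ∂P := by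
  have h₁ := (hind.precomp hτ).map_fun_eq_infinitePi_map₀
    (measurable_pi_lambda _ fun i => hξ (τ i)).aemeasurable
  have h₂ := hind.map_fun_eq_infinitePi_map₀ (measurable_pi_lambda _ hξ).aemeasurable
  simp only [hlaw] at h₁ h₂
  rw [← integral_map (φ := fun ω i => ξ (τ i) ω) (measurable_pi_lambda _ fun i => hξ (τ i)).aemeasurable
      hf.aestronglyMeasurable, ← integral_map (φ := fun ω i => ξ i ω)
      (measurable_pi_lambda _ hξ).aemeasurable hf.aestronglyMeasurable, h₁, h₂]

theorem measurable_of_dependsOn {ι 𝔸 : Type*} [Finite 𝔸] [MeasurableSpace 𝔸]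
    [MeasurableSingletonClass 𝔸] {f : (ι → 𝔸) → ℝ} {s : Finset ι} (hf : DependsOn f (s : Set ι)) :
    Measurable f := by
  obtain ⟨G, hG⟩ := dependsOn_iff_exists_comp.1 hf
  rw [hG]
  refine Measurable.comp (measurable_of_countable G) ?_
  exact measurable_pi_lambda _ fun i => measurable_pi_apply _

variable {ι 𝔸 Ω : Type*} [Finite 𝔸] [MeasurableSpace 𝔸]
  [MeasurableSingletonClass 𝔸] [MeasurableSpace Ω] {P : Measure Ω} [IsProbabilityMeasure P]
  {ξ : ι → Ω → 𝔸}

theorem integrable_of_dependsOn (hξ : ∀ i, Measurable (ξ i)) {f : (ι → 𝔸) → ℝ} {s : Finset ι}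
    (hf : DependsOn f (s : Set ι)) : Integrable (fun ω => f (fun i => ξ i ω)) P := by
  have hm := measurable_of_dependsOn hf
  obtain ⟨G, hG⟩ := dependsOn_iff_exists_comp.1 hf
  have hfin : (Set.range fun x => |G x|).Finite := Set.finite_range _
  obtain ⟨C, hC⟩ := hfin.bddAbove
  refine Integrable.of_bound (hm.comp (measurable_pi_lambda _ hξ)).aestronglyMeasurable C
    (ae_of_all _ fun ω => ?_)
  rw [hG]
  exact hC ⟨_, rfl⟩

variable [DecidableEq ι]

/-- Fubini: the letter `i` is independent of the letters in `s`, so it may be averaged separately.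
-/
theorem integral_eq_integral_resample (hξ : ∀ i, Measurable (ξ i)) (hind : iIndepFun ξ P)
    {f : (ι → 𝔸) → ℝ} {s : Finset ι} {i : ι} (hi : i ∉ s)
    (hf : DependsOn f ((insert i s : Finset ι) : Set ι)) :
    ∫ ω, f (fun j => ξ j ω) ∂P =
      ∫ ω, ∫ ω', f (Function.update (fun j => ξ j ω) i (ξ i ω')) ∂P ∂P := by
  classical
  have : Nonempty Ω := by
    by_contra h
    rw [not_nonempty_iff] at h
    have := measure_univ (μ := P)
    rw [Set.univ_eq_empty_iff.2 h, measure_empty] at this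
    exact zero_ne_one this
  obtain ⟨ω₀⟩ := ‹Nonempty Ω›
  -- Coordinates outside `insert i s` do not affect `f` and are frozen at `ω₀`, which leaves a
  -- function on a finite type.
  let G : (s → 𝔸) × 𝔸 → ℝ := fun p =>
    f (Function.update (fun j => if h : j ∈ s then p.1 ⟨j, h⟩ else ξ j ω₀) i p.2)
  have hG (x : ι → 𝔸) (a : 𝔸) : f (Function.update x i a) = G (fun j => x j, a) := by
    refine hf fun j hj => ?_
    rcases eq_or_ne j i with rfl | hne
    · simp
    · have : j ∈ s := by simpa [hne] using hj
      simp [hne, this]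
  have hU : Measurable fun ω (j : s) => ξ j ω := measurable_pi_lambda _ fun j => hξ j
  have hI : IndepFun (fun ω (j : s) => ξ j ω) (ξ i) P := by
    have h := hind.indepFun_finset s {i} (by simpa using hi) hξ
    exact h.comp measurable_id (measurable_pi_apply (⟨i, by simp⟩ : ({i} : Finset ι)))
  have hmap := hI.map_prod_eq_prod_map_map hU.aemeasurable (hξ i).aemeasurable
  have hGm : Measurable G := measurable_of_countable G
  have := Measure.isProbabilityMeasure_map (μ := P) hU.aemeasurable
  have := Measure.isProbabilityMeasure_map (μ := P) (hξ i).aemeasurable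
  calc ∫ ω, f (fun j => ξ j ω) ∂P
      = ∫ ω, G (fun j : s => ξ j ω, ξ i ω) ∂P := by
        refine integral_congr_ae (ae_of_all _ fun ω => ?_)
        have := hG (fun j => ξ j ω) (ξ i ω)
        simpa using this
    _ = ∫ p, G p ∂(P.map fun ω => ((fun j : s => ξ j ω), ξ i ω)) :=
        (integral_map (hU.prodMk (hξ i)).aemeasurable hGm.aestronglyMeasurable).symm
    _ = ∫ u, ∫ a, G (u, a) ∂(P.map (ξ i)) ∂(P.map fun ω (j : s) => ξ j ω) := by
        rw [hmap]
        exact integral_prod _ Integrable.of_finite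
    _ = ∫ ω, ∫ a, G (fun j : s => ξ j ω, a) ∂(P.map (ξ i)) ∂P :=
        integral_map hU.aemeasurable (measurable_of_countable _).aestronglyMeasurable
    _ = _ := by
        refine integral_congr_ae (ae_of_all _ fun ω => ?_)
        simp only [hG]
        exact integral_map (hξ i).aemeasurable (measurable_of_countable _).aestronglyMeasurable

/-- Hoeffding's lemma for a function of a letter whose values differ by at most `A`. -/
theorem integral_exp_le_of_abs_sub_le {X : Ω → 𝔸} (hX : Measurable X) {h : 𝔸 → ℝ} {A : ℝ}
    (hA : ∀ a b, |h a - h b| ≤ A) (t : ℝ) :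
    ∫ ω, Real.exp (t * (h (X ω) - ∫ ω', h (X ω') ∂P)) ∂P ≤ Real.exp (t ^ 2 * A ^ 2 / 8) := by
  rcases isEmpty_or_nonempty 𝔸 with he | hne
  · have : IsEmpty Ω := ⟨fun ω => he.elim (X ω)⟩
    have := measure_univ (μ := P)
    rw [Set.univ_eq_empty_iff.2 ‹_›, measure_empty] at this
    exact absurd this zero_ne_one
  obtain ⟨a₀, ha₀⟩ := Finite.exists_min h
  have hhX : Measurable fun ω => h (X ω) := (measurable_of_countable h).comp hX
  have hA0 : 0 ≤ A := (abs_nonneg _).trans (hA a₀ a₀)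
  -- The values lie in an interval of length `A` starting at the minimum of `h`; the variance proxy
  -- `(A / 2) ^ 2` gives the factor `1 / 8`.
  have H := (hasSubgaussianMGF_of_mem_Icc (μ := P) (a := h a₀) (b := h a₀ + A) hhX.aemeasurable
    (ae_of_all _ fun ω => ⟨ha₀ _, by linarith [le_abs_self (h (X ω) - h a₀), hA (X ω) a₀]⟩)).mgf_le t
  refine H.trans_eq ?_
  congr 1
  simp [abs_of_nonneg hA0]
  ring

/-- McDiarmid's inequality for moment generating functions. -/
theorem integral_exp_le_of_boundedDifferences (hξ : ∀ i, Measurable (ξ i)) (hind : iIndepFun ξ P)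
    {A : ℝ} (t : ℝ) (s : Finset ι) {f : (ι → 𝔸) → ℝ} (hf : DependsOn f (s : Set ι))
    (hA : ∀ x i a, |f (Function.update x i a) - f x| ≤ A) :
    ∫ ω, Real.exp (t * (f (fun i => ξ i ω) - ∫ ω', f (fun i => ξ i ω') ∂P)) ∂P ≤
      Real.exp (t ^ 2 * A ^ 2 / 8 * s.card) := by
  induction s using Finset.induction_on generalizing f with
  | empty =>
    have hc (ω ω' : Ω) : f (fun i => ξ i ω) = f (fun i => ξ i ω') := hf (by simp)
    have (ω : Ω) : ∫ ω', f (fun i => ξ i ω') ∂P = f (fun i => ξ i ω) := by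
      simp [fun ω' => hc ω' ω]
    refine (integral_congr_ae (g := fun _ => (1 : ℝ)) (ae_of_all _ fun ω => ?_)).trans_le (by simp)
    simp only
    rw [this ω, sub_self, mul_zero, Real.exp_zero]
  | insert i s hi ih =>
    -- Averaging out letter `i` keeps the mean and the difference bound. Hoeffding's lemma for that
    -- letter contributes one factor `exp (t ^ 2 * A ^ 2 / 8)`.
    let g : (ι → 𝔸) → ℝ := fun x => ∫ ω', f (Function.update x i (ξ i ω')) ∂P
    have hint (x : ι → 𝔸) : Integrable (fun ω' => f (Function.update x i (ξ i ω'))) P := by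
      have hfin : (Set.range fun a => |f (Function.update x i a)|).Finite := Set.finite_range _
      obtain ⟨C, hC⟩ := hfin.bddAbove
      exact Integrable.of_bound ((measurable_of_countable
        (fun a => f (Function.update x i a))).comp (hξ i)).aestronglyMeasurable C
        (ae_of_all _ fun ω => hC ⟨_, rfl⟩)
    have hg : DependsOn g (s : Set ι) := by
      intro x y hxy
      refine integral_congr_ae (ae_of_all _ fun ω' => hf fun j hj => ?_)
      rcases eq_or_ne j i with rfl | hne
      · simp
      · simpa [hne] using hxy j (by simpa [hne] using hj)
    have hA0 (x : ι → 𝔸) (a : 𝔸) : 0 ≤ A := (abs_nonneg _).trans (hA x i a)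
    have hgA : ∀ x j a, |g (Function.update x j a) - g x| ≤ A := by
      intro x j a
      simp only [g]
      rw [← integral_sub (hint _) (hint _), ← Real.norm_eq_abs]
      refine (norm_integral_le_of_norm_le_const (C := A) (ae_of_all _ fun ω' => ?_)).trans
        (by simp)
      rcases eq_or_ne j i with rfl | hne
      · simpa using hA0 x a
      · rw [Function.update_comm hne]
        exact hA _ _ _
    have hmean : ∫ ω, f (fun i => ξ i ω) ∂P = ∫ ω, g (fun i => ξ i ω) ∂P :=
      integral_eq_integral_resample hξ hind hi hf
    set m := ∫ ω, f (fun i => ξ i ω) ∂P with hm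
    rw [integral_eq_integral_resample (f := fun x => Real.exp (t * (f x - m))) hξ hind hi
      (DependsOn.comp_left hf fun v => Real.exp (t * (v - m)))]
    have hstep (x : ι → 𝔸) : ∫ ω', Real.exp (t * (f (Function.update x i (ξ i ω')) - m)) ∂P ≤
        Real.exp (t ^ 2 * A ^ 2 / 8) * Real.exp (t * (g x - m)) := by
      have h := integral_exp_le_of_abs_sub_le (P := P) (hξ i)
        (h := fun a => f (Function.update x i a)) (A := A) (fun a b => by
          have := hA (Function.update x i b) i a
          simpa using this) t
      calc ∫ ω', Real.exp (t * (f (Function.update x i (ξ i ω')) - m)) ∂P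
          = ∫ ω', Real.exp (t * (f (Function.update x i (ξ i ω')) - g x)) *
              Real.exp (t * (g x - m)) ∂P := by
            refine integral_congr_ae (ae_of_all _ fun ω' => ?_)
            simp only [← Real.exp_add]
            congr 1
            ring
        _ = (∫ ω', Real.exp (t * (f (Function.update x i (ξ i ω')) - g x)) ∂P) *
              Real.exp (t * (g x - m)) := integral_mul_const _ _
        _ ≤ _ := by gcongr
    have hdep : DependsOn (fun x => ∫ ω', Real.exp (t * (f (Function.update x i (ξ i ω')) - m)) ∂P)
        (s : Set ι) := by
      intro x y hxy
      refine integral_congr_ae (ae_of_all _ fun ω' => ?_)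
      simp only
      congr 3
      refine hf fun j hj => ?_
      rcases eq_or_ne j i with rfl | hne
      · simp
      · simpa [hne] using hxy j (by simpa [hne] using hj)
    have hgint : Integrable (fun ω => Real.exp (t * (g (fun i => ξ i ω) - m))) P :=
      integrable_of_dependsOn hξ (DependsOn.comp_left hg fun v => Real.exp (t * (v - m)))
    calc _ ≤ ∫ ω, Real.exp (t ^ 2 * A ^ 2 / 8) * Real.exp (t * (g (fun i => ξ i ω) - m)) ∂P :=
          integral_mono (integrable_of_dependsOn hξ hdep) (hgint.const_mul _) fun ω => hstep _
      _ = Real.exp (t ^ 2 * A ^ 2 / 8) * ∫ ω, Real.exp (t * (g (fun i => ξ i ω) - m)) ∂P :=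
          integral_const_mul _ _
      _ ≤ Real.exp (t ^ 2 * A ^ 2 / 8) * Real.exp (t ^ 2 * A ^ 2 / 8 * s.card) := by
          gcongr
          rw [hmean]
          exact ih hg hgA
      _ = _ := by
          rw [← Real.exp_add, Finset.card_insert_of_notMem hi]
          congr 1
          push_cast
          ring

end BoundedDifferences

/-! ### Alignments as sets of pairs in a box -/

section AlignedSets

/-- A finite set of pairs of positions is aligned if it is strictly increasing in both
coordinates. -/
def IsAligned (C : Finset (ℕ × ℕ)) : Prop :=
  ∀ p ∈ C, ∀ q ∈ C, p = q ∨ (p.1 < q.1 ∧ p.2 < q.2) ∨ (q.1 < p.1 ∧ q.2 < p.2)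

open Classical in
/-- The aligned sets of pairs in the box `[a, b) × [c, d)`. -/
def alignedSets (a b c d : ℕ) : Finset (Finset (ℕ × ℕ)) :=
  (Finset.Ico a b ×ˢ Finset.Ico c d).powerset.filter IsAligned

theorem mem_alignedSets {a b c d : ℕ} {C : Finset (ℕ × ℕ)} :
    C ∈ alignedSets a b c d ↔
      (∀ p ∈ C, (a ≤ p.1 ∧ p.1 < b) ∧ (c ≤ p.2 ∧ p.2 < d)) ∧ IsAligned C := by
  simp [alignedSets, Finset.subset_iff]

theorem empty_mem_alignedSets (a b c d : ℕ) : ∅ ∈ alignedSets a b c d := by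
  simp [mem_alignedSets, IsAligned]

variable {𝔸 : Type*}

/-- The total weight of a set of pairs; the first sequence is indexed by `Sum.inl`, the second
one by `Sum.inr`. -/
def weight (w : 𝔸 → 𝔸 → ℝ) (z : ℕ ⊕ ℕ → 𝔸) (C : Finset (ℕ × ℕ)) : ℝ :=
  ∑ p ∈ C, w (z (Sum.inl p.1)) (z (Sum.inr p.2))

/-- The largest weight of an aligned set in the box `[a, b) × [c, d)`. -/
def boxScore (w : 𝔸 → 𝔸 → ℝ) (z : ℕ ⊕ ℕ → 𝔸) (a b c d : ℕ) : ℝ :=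
  (alignedSets a b c d).sup' ⟨∅, empty_mem_alignedSets a b c d⟩ (weight w z)

variable {w : 𝔸 → 𝔸 → ℝ} {z : ℕ ⊕ ℕ → 𝔸} {a b c d : ℕ}

theorem weight_le_boxScore {C : Finset (ℕ × ℕ)} (hC : C ∈ alignedSets a b c d) :
    weight w z C ≤ boxScore w z a b c d :=
  Finset.le_sup' _ hC

theorem exists_boxScore_eq (w : 𝔸 → 𝔸 → ℝ) (z : ℕ ⊕ ℕ → 𝔸) (a b c d : ℕ) :
    ∃ C ∈ alignedSets a b c d, boxScore w z a b c d = weight w z C :=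
  Finset.exists_mem_eq_sup' _ _

/-- Push an optimal aligned set forward along `φ`; the symmetry and translation invariance of box
scores come from this. -/
theorem boxScore_le_boxScore {z' : ℕ ⊕ ℕ → 𝔸} {a' b' c' d' : ℕ} (φ : ℕ × ℕ → ℕ × ℕ)
    (hmem : ∀ C ∈ alignedSets a b c d, C.image φ ∈ alignedSets a' b' c' d')
    (hinj : Set.InjOn φ {p | (a ≤ p.1 ∧ p.1 < b) ∧ (c ≤ p.2 ∧ p.2 < d)})
    (hw : ∀ p : ℕ × ℕ, (a ≤ p.1 ∧ p.1 < b) ∧ (c ≤ p.2 ∧ p.2 < d) →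
      w (z (Sum.inl p.1)) (z (Sum.inr p.2)) = w (z' (Sum.inl (φ p).1)) (z' (Sum.inr (φ p).2))) :
    boxScore w z a b c d ≤ boxScore w z' a' b' c' d' := by
  obtain ⟨C, hC, h⟩ := exists_boxScore_eq w z a b c d
  have hbox := (mem_alignedSets.1 hC).1
  rw [h]
  refine le_trans (le_of_eq ?_) (weight_le_boxScore (hmem C hC))
  rw [weight, weight, Finset.sum_image (hinj.mono fun p hp => hbox p hp)]
  exact Finset.sum_congr rfl fun p hp => hw p (hbox p hp)

theorem boxScore_swap_le (hw : ∀ x y, w x y = w y x) :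
    boxScore w z a b c d ≤ boxScore w (z ∘ Sum.swap) c d a b := by
  refine boxScore_le_boxScore Prod.swap (fun C hC => ?_) Prod.swap_injective.injOn
    fun p _ => by simp [hw]
  rw [mem_alignedSets] at hC ⊢
  obtain ⟨h₁, h₂⟩ := hC
  simp only [IsAligned, Finset.forall_mem_image]
  refine ⟨fun p hp => (h₁ p hp).symm, fun p hp q hq => ?_⟩
  rcases h₂ p hp q hq with rfl | h | h
  · exact Or.inl rfl
  · exact Or.inr (Or.inl h.symm)
  · exact Or.inr (Or.inr h.symm)

theorem boxScore_swap (hw : ∀ x y, w x y = w y x) :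
    boxScore w (z ∘ Sum.swap) c d a b = boxScore w z a b c d := by
  refine le_antisymm ?_ (boxScore_swap_le hw)
  refine (boxScore_swap_le hw).trans_eq ?_
  congr 1
  funext i
  simp

theorem boxScore_shift (w : 𝔸 → 𝔸 → ℝ) (z : ℕ ⊕ ℕ → 𝔸) (a b c d : ℕ) :
    boxScore w z a b c d =
      boxScore w (z ∘ Sum.map (a + ·) (c + ·)) 0 (b - a) 0 (d - c) := by
  apply le_antisymm
  · refine boxScore_le_boxScore (fun p => (p.1 - a, p.2 - c)) (fun C hC => ?_) ?_ ?_
    · rw [mem_alignedSets] at hC ⊢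
      obtain ⟨h₁, h₂⟩ := hC
      simp only [IsAligned, Finset.forall_mem_image]
      refine ⟨fun p hp => ?_, fun p hp q hq => ?_⟩
      · have := h₁ p hp
        omega
      · have h := h₂ p hp q hq
        have := h₁ p hp
        have := h₁ q hq
        rw [Prod.ext_iff] at h ⊢
        simp only
        omega
    · intro p hp q hq h
      simp only [Set.mem_ofPred_eq, Prod.mk.injEq] at hp hq h
      rw [Prod.ext_iff]
      omega
    · intro p hp
      simp only [Function.comp, Sum.map_inl, Sum.map_inr]
      rw [Nat.add_sub_cancel' hp.1.1, Nat.add_sub_cancel' hp.2.1]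
  · refine boxScore_le_boxScore (fun p => (a + p.1, c + p.2)) (fun C hC => ?_) ?_ ?_
    · rw [mem_alignedSets] at hC ⊢
      obtain ⟨h₁, h₂⟩ := hC
      simp only [IsAligned, Finset.forall_mem_image]
      refine ⟨fun p hp => ?_, fun p hp q hq => ?_⟩
      · have := h₁ p hp
        omega
      · have h := h₂ p hp q hq
        rw [Prod.ext_iff] at h ⊢
        simp only
        omega
    · intro p _ q _ h
      simp only [Prod.mk.injEq] at h
      rw [Prod.ext_iff]
      omega
    · intro p _
      simp

/-- All pairs of the second box lie strictly above those of the first in both coordinates, so the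
union stays aligned. -/
theorem boxScore_add_le (w : 𝔸 → 𝔸 → ℝ) (z : ℕ ⊕ ℕ → 𝔸) {e f : ℕ} (hab : a ≤ b) (hbe : b ≤ e)
    (hcd : c ≤ d) (hdf : d ≤ f) :
    boxScore w z a b c d + boxScore w z b e d f ≤ boxScore w z a e c f := by
  obtain ⟨C, hC, h⟩ := exists_boxScore_eq w z a b c d
  obtain ⟨D, hD, h'⟩ := exists_boxScore_eq w z b e d f
  rw [mem_alignedSets] at hC hD
  have hdisj : Disjoint C D := Finset.disjoint_left.2 fun p hp hq => by
    have := hC.1 p hp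
    have := hD.1 p hq
    omega
  rw [h, h', weight, weight, ← Finset.sum_union hdisj]
  refine weight_le_boxScore (mem_alignedSets.2 ⟨fun p hp => ?_, fun p hp q hq => ?_⟩)
  · rcases Finset.mem_union.1 hp with hp | hp
    · have := hC.1 p hp
      omega
    · have := hD.1 p hp
      omega
  · rcases Finset.mem_union.1 hp with hp | hp <;> rcases Finset.mem_union.1 hq with hq | hq
    · exact hC.2 p hp q hq
    · have := hC.1 p hp
      have := hD.1 q hq
      omega
    · have := hD.1 p hp
      have := hC.1 q hq
      omega
    · exact hD.2 p hp q hq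

theorem le_boxScore_succ (w : 𝔸 → 𝔸 → ℝ) (z : ℕ ⊕ ℕ → 𝔸) (a c : ℕ) :
    w (z (Sum.inl a)) (z (Sum.inr c)) ≤ boxScore w z a (a + 1) c (c + 1) := by
  have h : {(a, c)} ∈ alignedSets a (a + 1) c (c + 1) := by simp [mem_alignedSets, IsAligned]
  simpa [weight] using weight_le_boxScore (w := w) (z := z) h

theorem dependsOn_boxScore (w : 𝔸 → 𝔸 → ℝ) (a b c d : ℕ) :
    DependsOn (fun z => boxScore w z a b c d)
      (((Finset.Ico a b).disjSum (Finset.Ico c d) : Finset (ℕ ⊕ ℕ)) : Set (ℕ ⊕ ℕ)) := by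
  intro z z' h
  refine Finset.sup'_congr _ rfl fun C hC => Finset.sum_congr rfl fun p hp => ?_
  have := (mem_alignedSets.1 hC).1 p hp
  rw [h (Sum.inl p.1) (by simpa using this.1), h (Sum.inr p.2) (by simpa using this.2)]

theorem abs_weight_update_sub_le {A : ℝ} (hA₁ : ∀ x x' y, |w x y - w x' y| ≤ A)
    (hA₂ : ∀ x y y', |w x y - w x y'| ≤ A) {C : Finset (ℕ × ℕ)} (hC : IsAligned C) (z : ℕ ⊕ ℕ → 𝔸)
    (k : ℕ ⊕ ℕ) (x : 𝔸) : |weight w (Function.update z k x) C - weight w z C| ≤ A := by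
  have hA0 : 0 ≤ A := (abs_nonneg _).trans (hA₁ x x x)
  let T : Finset (ℕ × ℕ) := C.filter fun p => Sum.inl p.1 = k ∨ Sum.inr p.2 = k
  -- Alignment is strict in both coordinates, so each letter is used by at most one pair.
  have hT : T.card ≤ 1 := by
    refine Finset.card_le_one.2 fun p hp q hq => ?_
    simp only [T, Finset.mem_filter] at hp hq
    have h := hC p hp.1 q hq.1
    rcases k with i | i
    · simp only [Sum.inl.injEq, reduceCtorEq, or_false] at hp hq
      have : ¬ (p.1 < q.1 ∧ p.2 < q.2) := by omega
      have : ¬ (q.1 < p.1 ∧ q.2 < p.2) := by omega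
      tauto
    · simp only [Sum.inr.injEq, reduceCtorEq, false_or] at hp hq
      have : ¬ (p.1 < q.1 ∧ p.2 < q.2) := by omega
      have : ¬ (q.1 < p.1 ∧ q.2 < p.2) := by omega
      tauto
  rw [weight, weight, ← Finset.sum_sub_distrib]
  calc _ ≤ ∑ p ∈ C, |w (Function.update z k x (Sum.inl p.1)) (Function.update z k x (Sum.inr p.2)) -
          w (z (Sum.inl p.1)) (z (Sum.inr p.2))| := Finset.abs_sum_le_sum_abs _ _
    _ ≤ ∑ p ∈ C, if Sum.inl p.1 = k ∨ Sum.inr p.2 = k then A else 0 := by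
        refine Finset.sum_le_sum fun p _ => ?_
        rcases k with i | i
        · by_cases h : p.1 = i
          · simpa [h] using hA₁ _ _ _
          · simp [h]
        · by_cases h : p.2 = i
          · simpa [h] using hA₂ _ _ _
          · simp [h]
    _ = T.card * A := by rw [← Finset.sum_filter]; simp [T]
    _ ≤ 1 * A := by gcongr; exact_mod_cast hT
    _ = A := one_mul A

theorem abs_boxScore_update_sub_le {A : ℝ} (hA₁ : ∀ x x' y, |w x y - w x' y| ≤ A)
    (hA₂ : ∀ x y y', |w x y - w x y'| ≤ A) (z : ℕ ⊕ ℕ → 𝔸) (k : ℕ ⊕ ℕ) (x : 𝔸) :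
    |boxScore w (Function.update z k x) a b c d - boxScore w z a b c d| ≤ A := by
  rw [abs_le]
  constructor
  · obtain ⟨C, hC, h⟩ := exists_boxScore_eq w z a b c d
    have h₁ := abs_le.1 (abs_weight_update_sub_le hA₁ hA₂ (mem_alignedSets.1 hC).2 z k x)
    have h₂ := weight_le_boxScore (w := w) (z := Function.update z k x) hC
    linarith [h₁.1]
  · obtain ⟨C, hC, h⟩ := exists_boxScore_eq w (Function.update z k x) a b c d
    have h₁ := abs_le.1 (abs_weight_update_sub_le hA₁ hA₂ (mem_alignedSets.1 hC).2 z k x)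
    have h₂ := weight_le_boxScore (w := w) (z := z) hC
    linarith [h₁.2]

/-- The optimal score is the largest weight of an aligned set, corrected by the gap price. -/
theorem optimalScore_eq_boxScore (S : 𝔸 → 𝔸 → ℝ) (δ : ℝ) (z : ℕ ⊕ ℕ → 𝔸) (n : ℕ) :
    optimalScore S δ (fun i : Fin n => z (Sum.inl i)) (fun i : Fin n => z (Sum.inr i)) =
      boxScore (fun x y => S x y - δ) z 0 n 0 n + δ * n := by
  obtain ⟨⟨α, hα⟩, hmax⟩ := isGreatest_optimalScore S δ (fun i : Fin n => z (Sum.inl i))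
    (fun i : Fin n => z (Sum.inr i))
  apply le_antisymm
  · rw [← hα]
    let φ : Fin α.k → ℕ × ℕ := fun i => (α.fst i, α.snd i)
    have hφ : φ.Injective := fun i j h =>
      α.fst_strictMono.injective (Fin.ext (Prod.ext_iff.1 h).1)
    have hC : Finset.univ.image φ ∈ alignedSets 0 n 0 n := by
      rw [mem_alignedSets]
      simp only [IsAligned, Finset.forall_mem_image]
      refine ⟨fun i _ => by simp [φ], fun i _ j _ => ?_⟩
      rcases lt_trichotomy i j with h | rfl | h
      · exact Or.inr (Or.inl ⟨α.fst_strictMono h, α.snd_strictMono h⟩)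
      · exact Or.inl rfl
      · exact Or.inr (Or.inr ⟨α.fst_strictMono h, α.snd_strictMono h⟩)
    have h := weight_le_boxScore (w := fun x y => S x y - δ) (z := z) hC
    rw [weight, Finset.sum_image hφ.injOn] at h
    simp only [φ, Finset.sum_sub_distrib, Finset.sum_const, Finset.card_univ, Fintype.card_fin,
      nsmul_eq_mul] at h
    rw [alignmentScore]
    linarith
  · obtain ⟨C, hC, h⟩ := exists_boxScore_eq (fun x y => S x y - δ) z 0 n 0 n
    obtain ⟨hbox, hal⟩ := mem_alignedSets.1 hC
    -- On an aligned set the lexicographic order is strictly increasing in both coordinates, so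
    -- enumerating by it yields an alignment.
    let C' : Finset (ℕ ×ₗ ℕ) := C.map toLex.toEmbedding
    have hcard : C'.card = C.card := Finset.card_map _
    let e := C'.orderEmbOfFin hcard
    have he (i) : ofLex (e i) ∈ C := by
      have := C'.orderEmbOfFin_mem hcard i
      simpa [C'] using this
    have hlt {i j} (hij : i < j) : (ofLex (e i)).1 < (ofLex (e j)).1 ∧
        (ofLex (e i)).2 < (ofLex (e j)).2 := by
      have hl : e i < e j := e.strictMono hij
      rw [Prod.Lex.lt_iff] at hl
      rcases hal _ (he i) _ (he j) with h | h | h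
      · rw [h] at hl
        omega
      · exact h
      · omega
    let β : Alignment n :=
      { k := C.card
        fst := fun i => ⟨(ofLex (e i)).1, (hbox _ (he i)).1.2⟩
        snd := fun i => ⟨(ofLex (e i)).2, (hbox _ (he i)).2.2⟩
        fst_strictMono := fun i j hij => (hlt hij).1
        snd_strictMono := fun i j hij => (hlt hij).2 }
    have hβ := hmax ⟨β, rfl⟩
    refine le_trans (le_of_eq ?_) hβ
    have hsum : ∑ i : Fin C.card, S (z (Sum.inl (ofLex (e i)).1)) (z (Sum.inr (ofLex (e i)).2)) =
        ∑ p ∈ C, S (z (Sum.inl p.1)) (z (Sum.inr p.2)) := by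
      have h₁ : ∑ p ∈ C, S (z (Sum.inl p.1)) (z (Sum.inr p.2)) =
          ∑ p ∈ C', S (z (Sum.inl (ofLex p).1)) (z (Sum.inr (ofLex p).2)) := by
        simp [C']
      rw [h₁, ← C'.map_orderEmbOfFin_univ hcard, Finset.sum_map]
      rfl
    rw [h, weight, alignmentScore]
    simp only [β, hsum, Finset.sum_sub_distrib, Finset.sum_const, nsmul_eq_mul]
    ring

end AlignedSets

/-! ### Cutting an alignment into short boxes -/

section Cuts

variable {𝔸 : Type*} {w : 𝔸 → 𝔸 → ℝ} {δ : ℝ} {N n : ℕ}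

/-- The score of a box, including the gap price for all positions of both its sides. -/
def gappedBoxScore (w : 𝔸 → 𝔸 → ℝ) (δ : ℝ) (z : ℕ ⊕ ℕ → 𝔸) (a b c d : ℕ) : ℝ :=
  boxScore w z a b c d + δ / 2 * ((b - a + (d - c) : ℕ) : ℝ)

/-- The sum of the scores of the successive boxes that the increments in a list cut out of
`[0, N) × [0, N)`, starting from the point `p`. -/
def cutScore (w : 𝔸 → 𝔸 → ℝ) (δ : ℝ) (N : ℕ) (z : ℕ ⊕ ℕ → 𝔸) : ℕ × ℕ → List (ℕ × ℕ) → ℝ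
  | _, [] => 0
  | p, e :: l =>
    gappedBoxScore w δ z p.1 (min (p.1 + e.1) N) p.2 (min (p.2 + e.2) N) +
      cutScore w δ N z (p + e) l

theorem dependsOn_gappedBoxScore (w : 𝔸 → 𝔸 → ℝ) (δ : ℝ) (a b c d : ℕ) :
    DependsOn (fun z => gappedBoxScore w δ z a b c d)
      (((Finset.Ico a b).disjSum (Finset.Ico c d) : Finset (ℕ ⊕ ℕ)) : Set (ℕ ⊕ ℕ)) :=
  DependsOn.comp_left (dependsOn_boxScore w a b c d) fun v => v + _

theorem dependsOn_cutScore (w : 𝔸 → 𝔸 → ℝ) (δ : ℝ) (N : ℕ) (p : ℕ × ℕ) (l : List (ℕ × ℕ)) :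
    DependsOn (fun z => cutScore w δ N z p l)
      (((Finset.Ico p.1 N).disjSum (Finset.Ico p.2 N) : Finset (ℕ ⊕ ℕ)) : Set (ℕ ⊕ ℕ)) := by
  induction l generalizing p with
  | nil => intro _ _ _; rfl
  | cons e l ih =>
    intro z z' h
    simp only [cutScore]
    congr 1
    · refine dependsOn_gappedBoxScore w δ _ _ _ _ fun k hk => h k ?_
      rcases k with i | i <;> simp at hk ⊢ <;> omega
    · refine ih (p + e) fun k hk => h k ?_
      rcases k with i | i <;> simp at hk ⊢ <;> omega

/-- The boxes use disjoint sets of letters, so one letter affects at most one of them: the bound is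
`A`, whatever the number of boxes. -/
theorem abs_cutScore_update_sub_le {A : ℝ} (hA₁ : ∀ x x' y, |w x y - w x' y| ≤ A)
    (hA₂ : ∀ x y y', |w x y - w x y'| ≤ A) (p : ℕ × ℕ) (l : List (ℕ × ℕ)) (z : ℕ ⊕ ℕ → 𝔸)
    (k : ℕ ⊕ ℕ) (x : 𝔸) :
    |cutScore w δ N (Function.update z k x) p l - cutScore w δ N z p l| ≤ A := by
  induction l generalizing p with
  | nil => simpa [cutScore] using (abs_nonneg _).trans (hA₁ x x x)
  | cons e l ih =>
    simp only [cutScore]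
    by_cases hk : k ∈ (Finset.Ico (p + e).1 N).disjSum (Finset.Ico (p + e).2 N)
    · have h : gappedBoxScore w δ (Function.update z k x) p.1 (min (p.1 + e.1) N) p.2
          (min (p.2 + e.2) N) =
          gappedBoxScore w δ z p.1 (min (p.1 + e.1) N) p.2 (min (p.2 + e.2) N) := by
        refine dependsOn_gappedBoxScore w δ _ _ _ _ fun j hj => ?_
        have : j ≠ k := by
          rintro rfl
          rcases j with i | i <;> simp at hk hj <;> omega
        simp [this]
      rw [h, add_sub_add_left_eq_sub]
      exact ih _
    · have h : cutScore w δ N (Function.update z k x) (p + e) l = cutScore w δ N z (p + e) l := by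
        refine dependsOn_cutScore w δ N (p + e) l fun j hj => ?_
        have : j ≠ k := by
          rintro rfl
          exact hk hj
        simp [this]
      rw [h, add_sub_add_right_eq_sub, gappedBoxScore, gappedBoxScore, add_sub_add_right_eq_sub]
      exact abs_boxScore_update_sub_le hA₁ hA₂ z k x

/-- The increments of combined length `n - 1` or `n`. -/
def increments (n : ℕ) : Finset (ℕ × ℕ) :=
  Finset.HasAntidiagonal.antidiagonal (n - 1) ∪ Finset.HasAntidiagonal.antidiagonal n

theorem mem_increments {e : ℕ × ℕ} :
    e ∈ increments n ↔ e.1 + e.2 = n - 1 ∨ e.1 + e.2 = n := by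
  simp [increments]

theorem card_increments_le (hn : 1 ≤ n) : (increments n).card ≤ 2 * n + 1 := by
  refine (Finset.card_union_le _ _).trans ?_
  simp only [Finset.Nat.card_antidiagonal]
  omega

/-- The lists of `m` increments of combined length `n - 1` or `n`. -/
def incrementLists (n : ℕ) : ℕ → Finset (List (ℕ × ℕ))
  | 0 => {[]}
  | m + 1 => (increments n ×ˢ incrementLists n m).image fun q => q.1 :: q.2

theorem cons_mem_incrementLists {m : ℕ} {e : ℕ × ℕ} {l : List (ℕ × ℕ)} (he : e ∈ increments n)
    (hl : l ∈ incrementLists n m) : e :: l ∈ incrementLists n (m + 1) :=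
  Finset.mem_image.2 ⟨(e, l), Finset.mem_product.2 ⟨he, hl⟩, rfl⟩

theorem card_incrementLists_le (hn : 1 ≤ n) (m : ℕ) :
    (incrementLists n m).card ≤ (2 * n + 1) ^ m := by
  induction m with
  | zero => simp [incrementLists]
  | succ m ih =>
    refine Finset.card_image_le.trans ?_
    rw [Finset.card_product, pow_succ']
    exact Nat.mul_le_mul (card_increments_le hn) ih

/-- The point `p` does not separate the two entries of a pair in `C`, and it is comparable
with `(N, N)`. -/
def IsCutPoint (C : Finset (ℕ × ℕ)) (N : ℕ) (p : ℕ × ℕ) : Prop :=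
  (∀ q ∈ C, (q.1 < p.1 ∧ q.2 < p.2) ∨ (p.1 ≤ q.1 ∧ p.2 ≤ q.2)) ∧
    ((p.1 ≤ N ∧ p.2 ≤ N) ∨ (N ≤ p.1 ∧ N ≤ p.2))

variable {C : Finset (ℕ × ℕ)}

/-- A pair located at `p` must be passed diagonally, which costs length 2. Otherwise a unit step
suffices: upwards if the column of `p` holds a pair, which then lies higher, and sideways if the
column is empty and the border not reached. Past `(N, N)` any step works. -/
theorem IsCutPoint.exists_succ (hC : C ∈ alignedSets 0 N 0 N) {p : ℕ × ℕ}
    (hp : IsCutPoint C N p) :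
    ∃ e : ℕ × ℕ, (e.1 + e.2 = 1 ∨ e.1 + e.2 = 2) ∧ IsCutPoint C N (p + e) := by
  obtain ⟨hbox, hal⟩ := mem_alignedSets.1 hC
  obtain ⟨hp₁, hp₂⟩ := hp
  simp only [IsCutPoint, Prod.fst_add, Prod.snd_add]
  by_cases hT : N ≤ p.1 ∧ N ≤ p.2
  · refine ⟨(1, 0), Or.inl rfl, fun q hq => ?_, ?_⟩
    · have := hbox q hq
      omega
    · simp only
      omega
  have hp₃ : p.1 ≤ N ∧ p.2 ≤ N := by omega
  by_cases hpC : p ∈ C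
  · have := hbox p hpC
    refine ⟨(1, 1), Or.inr rfl, fun q hq => ?_, ?_⟩
    · have := hal p hpC q hq
      rw [Prod.ext_iff] at this
      simp only
      omega
    · simp only
      omega
  by_cases hcol : ∃ q ∈ C, q.1 = p.1
  · obtain ⟨q, hq, hqp⟩ := hcol
    have h₁ := hp₁ q hq
    have h₂ : q.2 ≠ p.2 := fun h => hpC (by rwa [← Prod.ext hqp h])
    have := hbox q hq
    refine ⟨(0, 1), Or.inl rfl, fun r hr => ?_, ?_⟩
    · have h₃ := hal q hq r hr
      have h₄ := hp₁ r hr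
      rw [Prod.ext_iff] at h₃
      simp only
      omega
    · simp only
      omega
  · push Not at hcol
    by_cases hN : p.1 < N
    · refine ⟨(1, 0), Or.inl rfl, fun r hr => ?_, ?_⟩
      · have h₃ := hcol r hr
        have h₄ := hp₁ r hr
        simp only
        omega
      · simp only
        omega
    · refine ⟨(0, 1), Or.inl rfl, fun r hr => ?_, ?_⟩
      · have h₃ := hbox r hr
        have h₄ := hp₁ r hr
        simp only
        omega
      · simp only
        omega

/-- Steps of length 1 or 2 overshoot a prescribed total by at most 1; hence the two lengths in
`increments`. -/
theorem IsCutPoint.exists_add (hC : C ∈ alignedSets 0 N 0 N) {p : ℕ × ℕ} (hp : IsCutPoint C N p)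
    (k : ℕ) : ∃ e : ℕ × ℕ, (e.1 + e.2 = k ∨ e.1 + e.2 = k + 1) ∧ IsCutPoint C N (p + e) := by
  induction k with
  | zero => exact ⟨0, Or.inl rfl, by simpa using hp⟩
  | succ k ih =>
    obtain ⟨e, h | h, he⟩ := ih
    · obtain ⟨e', h', he'⟩ := he.exists_succ hC
      refine ⟨e + e', ?_, by rwa [← add_assoc]⟩
      simp only [Prod.fst_add, Prod.snd_add]
      omega
    · exact ⟨e, Or.inl h, he⟩

theorem IsCutPoint.exists_weight_le_cutScore (w : 𝔸 → 𝔸 → ℝ) (δ : ℝ) (z : ℕ ⊕ ℕ → 𝔸)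
    (hn : 1 ≤ n) (hC : C ∈ alignedSets 0 N 0 N) (m : ℕ) {p : ℕ × ℕ} (hp : IsCutPoint C N p)
    (hm : 2 * N ≤ p.1 + p.2 + m * (n - 1)) :
    ∃ l ∈ incrementLists n m,
      weight w z (C.filter (p ≤ ·)) + δ / 2 * ((N - p.1 + (N - p.2) : ℕ) : ℝ) ≤
        cutScore w δ N z p l := by
  obtain ⟨hbox, hal⟩ := mem_alignedSets.1 hC
  induction m generalizing p with
  | zero =>
    -- Comparability with `(N, N)` turns `2 * N ≤ p.1 + p.2` into a bound on each coordinate.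
    have hT : N ≤ p.1 ∧ N ≤ p.2 := by
      have := hp.2
      omega
    refine ⟨[], by simp [incrementLists], ?_⟩
    have h : C.filter (p ≤ ·) = ∅ := Finset.filter_eq_empty_iff.2 fun q hq hpq => by
      have := hbox q hq
      rw [Prod.le_def] at hpq
      omega
    simp [h, weight, cutScore, Nat.sub_eq_zero_of_le hT.1, Nat.sub_eq_zero_of_le hT.2]
  | succ m ih =>
    obtain ⟨e, he, hpe⟩ := hp.exists_add hC (n - 1)
    have he' : e ∈ increments n := mem_increments.2 (by omega)
    obtain ⟨l, hl, hle⟩ := ih hpe (by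
      rw [add_mul, one_mul] at hm
      simp only [Prod.fst_add, Prod.snd_add]
      omega)
    refine ⟨e :: l, cons_mem_incrementLists he' hl, ?_⟩
    simp only [Prod.fst_add, Prod.snd_add] at hle
    -- By the cut property at `p + e`, pairs not above it lie strictly below it in both coordinates,
    -- hence in the first box.
    let B := C.filter fun q => p ≤ q ∧ ¬ p + e ≤ q
    have hB : B ∈ alignedSets p.1 (min (p.1 + e.1) N) p.2 (min (p.2 + e.2) N) := by
      refine mem_alignedSets.2 ⟨fun q hq => ?_, fun q hq r hr =>
        hal q (Finset.mem_filter.1 hq).1 r (Finset.mem_filter.1 hr).1⟩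
      obtain ⟨hqC, hq⟩ := Finset.mem_filter.1 hq
      have h₁ := hbox q hqC
      have h₂ := hpe.1 q hqC
      simp only [Prod.le_def, Prod.fst_add, Prod.snd_add] at hq h₂
      omega
    have hsplit : weight w z (C.filter (p ≤ ·)) =
        weight w z B + weight w z (C.filter (p + e ≤ ·)) := by
      rw [weight, weight, weight, ← Finset.sum_union]
      · refine Finset.sum_congr ?_ fun _ _ => rfl
        ext q
        simp only [B, Finset.mem_union, Finset.mem_filter, Prod.le_def, Prod.fst_add, Prod.snd_add]
        by_cases hq : q ∈ C
        · simp only [hq, true_and]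
          omega
        · simp only [hq, false_and, or_false]
      · refine Finset.disjoint_left.2 fun q hq hq' => ?_
        exact (Finset.mem_filter.1 hq).2.2 (Finset.mem_filter.1 hq').2
    have hlen : N - p.1 + (N - p.2) =
        (min (p.1 + e.1) N - p.1 + (min (p.2 + e.2) N - p.2)) +
          (N - (p.1 + e.1) + (N - (p.2 + e.2))) := by omega
    rw [hsplit, hlen, cutScore, gappedBoxScore, Nat.cast_add (min (p.1 + e.1) N - p.1 + _)]
    have := weight_le_boxScore (w := w) (z := z) hB
    linarith

/-- The score of two sequences of length `N` is at most the largest cut score. -/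
theorem exists_boxScore_le_cutScore (w : 𝔸 → 𝔸 → ℝ) (δ : ℝ) (z : ℕ ⊕ ℕ → 𝔸) (hn : 1 ≤ n) {m : ℕ}
    (hm : 2 * N ≤ m * (n - 1)) :
    ∃ l ∈ incrementLists n m, boxScore w z 0 N 0 N + δ * N ≤ cutScore w δ N z 0 l := by
  obtain ⟨C, hC, h⟩ := exists_boxScore_eq w z 0 N 0 N
  have h0 : IsCutPoint C N 0 := ⟨fun q _ => by simp, by simp⟩
  obtain ⟨l, hl, hle⟩ := h0.exists_weight_le_cutScore w δ z hn hC m (by simpa using hm)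
  refine ⟨l, hl, le_trans (le_of_eq ?_) hle⟩
  have hf : C.filter ((0 : ℕ × ℕ) ≤ ·) = C :=
    Finset.filter_true_of_mem fun q _ => by simp
  rw [hf, h]
  simp only [Prod.fst_zero, Prod.snd_zero, Nat.sub_zero]
  push_cast
  ring

end Cuts

/-! ### Mean scores and the comparison of lengths -/

section MeanScores

variable {𝔸 Ω : Type*} [Finite 𝔸] [MeasurableSpace 𝔸] [MeasurableSingletonClass 𝔸]
  [MeasurableSpace Ω] {P : Measure Ω} {ξ : ℕ ⊕ ℕ → Ω → 𝔸}
  {μ : Measure 𝔸} {w : 𝔸 → 𝔸 → ℝ} {δ : ℝ}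

/-- The mean gapped score of the first `i` letters and the first `j` letters of the two random
sequences. -/
def meanBoxScore (P : Measure Ω) (ξ : ℕ ⊕ ℕ → Ω → 𝔸) (w : 𝔸 → 𝔸 → ℝ) (δ : ℝ) (i j : ℕ) : ℝ :=
  ∫ ω, gappedBoxScore w δ (fun k => ξ k ω) 0 i 0 j ∂P

theorem integral_gappedBoxScore (hξ : ∀ i, Measurable (ξ i)) (hind : iIndepFun ξ P)
    (hlaw : ∀ i, P.map (ξ i) = μ) (a b c d : ℕ) :
    ∫ ω, gappedBoxScore w δ (fun k => ξ k ω) a b c d ∂P = meanBoxScore P ξ w δ (b - a) (d - c) := by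
  have hτ : (Sum.map (a + ·) (c + ·) : ℕ ⊕ ℕ → ℕ ⊕ ℕ).Injective :=
    Sum.map_injective.2 ⟨add_right_injective a, add_right_injective c⟩
  rw [meanBoxScore, ← integral_reindex hξ hind hlaw
    (measurable_of_dependsOn (dependsOn_gappedBoxScore w δ 0 (b - a) 0 (d - c))) hτ]
  refine integral_congr_ae (ae_of_all _ fun ω => ?_)
  simp only [gappedBoxScore, Nat.sub_zero]
  rw [boxScore_shift]
  rfl

theorem meanBoxScore_comm (hw : ∀ x y, w x y = w y x) (hξ : ∀ i, Measurable (ξ i))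
    (hind : iIndepFun ξ P) (hlaw : ∀ i, P.map (ξ i) = μ) (i j : ℕ) :
    meanBoxScore P ξ w δ i j = meanBoxScore P ξ w δ j i := by
  have hτ : (Sum.swap : ℕ ⊕ ℕ → ℕ ⊕ ℕ).Injective := Sum.swap_leftInverse.injective
  rw [meanBoxScore, meanBoxScore, ← integral_reindex hξ hind hlaw
    (measurable_of_dependsOn (dependsOn_gappedBoxScore w δ 0 j 0 i)) hτ]
  refine integral_congr_ae (ae_of_all _ fun ω => ?_)
  simp only [gappedBoxScore, Nat.sub_zero]
  rw [add_comm j i, ← boxScore_swap hw]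
  rfl

variable [IsProbabilityMeasure P]

theorem integrable_gappedBoxScore (hξ : ∀ i, Measurable (ξ i)) (a b c d : ℕ) :
    Integrable (fun ω => gappedBoxScore w δ (fun k => ξ k ω) a b c d) P :=
  integrable_of_dependsOn hξ (dependsOn_gappedBoxScore w δ a b c d)

theorem meanBoxScore_add_le (hξ : ∀ i, Measurable (ξ i)) (hind : iIndepFun ξ P)
    (hlaw : ∀ i, P.map (ξ i) = μ) (i j i' j' : ℕ) :
    meanBoxScore P ξ w δ i j + meanBoxScore P ξ w δ i' j' ≤
      meanBoxScore P ξ w δ (i + i') (j + j') := by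
  have h := integral_gappedBoxScore (w := w) (δ := δ) hξ hind hlaw i (i + i') j (j + j')
  rw [Nat.add_sub_cancel_left, Nat.add_sub_cancel_left] at h
  rw [← h, meanBoxScore, meanBoxScore, ← integral_add (integrable_gappedBoxScore hξ _ _ _ _)
    (integrable_gappedBoxScore hξ _ _ _ _)]
  refine integral_mono ((integrable_gappedBoxScore hξ _ _ _ _).add
    (integrable_gappedBoxScore hξ _ _ _ _)) (integrable_gappedBoxScore hξ _ _ _ _) fun ω => ?_
  have := boxScore_add_le w (fun k => ξ k ω) (Nat.zero_le i) (Nat.le_add_right i i')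
    (Nat.zero_le j) (Nat.le_add_right j j')
  simp only [gappedBoxScore, Nat.sub_zero, Nat.add_sub_cancel_left]
  push_cast
  linarith

/-- Appending one aligned pair adds `w + δ`, which is nonnegative. -/
theorem meanBoxScore_self_mono (hwδ : ∀ x y, 0 ≤ w x y + δ) (hξ : ∀ i, Measurable (ξ i))
    (hind : iIndepFun ξ P) (hlaw : ∀ i, P.map (ξ i) = μ) :
    Monotone fun s => meanBoxScore P ξ w δ s s := by
  refine monotone_nat_of_le_succ fun s => ?_
  have h₁ := meanBoxScore_add_le (w := w) (δ := δ) hξ hind hlaw s s 1 1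
  have h₂ : 0 ≤ meanBoxScore P ξ w δ 1 1 := by
    refine integral_nonneg fun ω => ?_
    have := le_boxScore_succ w (fun k => ξ k ω) 0 0
    have := hwδ (ξ (Sum.inl 0) ω) (ξ (Sum.inr 0) ω)
    simp only [Pi.zero_apply, gappedBoxScore]
    norm_num at *
    linarith
  linarith

/-- An `i × j` box and a `j × i` box have the same mean and, glued at a corner, fit into a square of
side `i + j`. -/
theorem two_mul_meanBoxScore_le (hw : ∀ x y, w x y = w y x) (hwδ : ∀ x y, 0 ≤ w x y + δ)
    (hξ : ∀ i, Measurable (ξ i)) (hind : iIndepFun ξ P) (hlaw : ∀ i, P.map (ξ i) = μ) {i j n : ℕ}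
    (h : i + j ≤ n) : 2 * meanBoxScore P ξ w δ i j ≤ meanBoxScore P ξ w δ n n := by
  have h₁ := meanBoxScore_add_le (w := w) (δ := δ) hξ hind hlaw i j j i
  rw [← meanBoxScore_comm hw hξ hind hlaw i j, add_comm j i] at h₁
  have h₂ := meanBoxScore_self_mono hwδ hξ hind hlaw h
  simp only at h₂
  linarith

theorem integrable_cutScore (hξ : ∀ i, Measurable (ξ i)) (N : ℕ) (p : ℕ × ℕ) (l : List (ℕ × ℕ)) :
    Integrable (fun ω => cutScore w δ N (fun k => ξ k ω) p l) P :=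
  integrable_of_dependsOn hξ (dependsOn_cutScore w δ N p l)

theorem integral_cutScore_le (hw : ∀ x y, w x y = w y x) (hwδ : ∀ x y, 0 ≤ w x y + δ)
    (hξ : ∀ i, Measurable (ξ i)) (hind : iIndepFun ξ P) (hlaw : ∀ i, P.map (ξ i) = μ) (N n m : ℕ)
    (p : ℕ × ℕ) {l : List (ℕ × ℕ)} (hl : l ∈ incrementLists n m) :
    ∫ ω, cutScore w δ N (fun k => ξ k ω) p l ∂P ≤ m * (meanBoxScore P ξ w δ n n / 2) := by
  induction m generalizing p l with
  | zero =>
    obtain rfl : l = [] := by simpa [incrementLists] using hl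
    simp [cutScore]
  | succ m ih =>
    obtain ⟨⟨e, l⟩, he, rfl⟩ := Finset.mem_image.1 hl
    obtain ⟨he, hl⟩ := Finset.mem_product.1 he
    rw [mem_increments] at he
    simp only [cutScore]
    rw [integral_add (integrable_gappedBoxScore hξ _ _ _ _) (integrable_cutScore hξ _ _ _),
      integral_gappedBoxScore hξ hind hlaw]
    have h₁ := ih (p + e) hl
    have h₂ := two_mul_meanBoxScore_le hw hwδ hξ hind hlaw (n := n)
      (i := min (p.1 + e.1) N - p.1) (j := min (p.2 + e.2) N - p.2) (by simp only at he; omega)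
    push_cast
    linarith

/-- The mean score for length `N` is controlled by the mean score for length `n`. -/
theorem mul_meanBoxScore_le {A : ℝ} (hA₁ : ∀ x x' y, |w x y - w x' y| ≤ A)
    (hA₂ : ∀ x y y', |w x y - w x y'| ≤ A) (hw : ∀ x y, w x y = w y x)
    (hwδ : ∀ x y, 0 ≤ w x y + δ) (hξ : ∀ i, Measurable (ξ i)) (hind : iIndepFun ξ P)
    (hlaw : ∀ i, P.map (ξ i) = μ) {N n m : ℕ} (hn : 1 ≤ n) (hm : 2 * N ≤ m * (n - 1)) {t : ℝ}
    (ht : 0 ≤ t) :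
    t * meanBoxScore P ξ w δ N N ≤ t * (m * (meanBoxScore P ξ w δ n n / 2)) +
      t ^ 2 * A ^ 2 / 4 * N + m * Real.log (2 * n + 1) := by
  set E := m * (meanBoxScore P ξ w δ n n / 2) with hE
  -- `K` is chosen so that each cut has exponential moment at most `(2n + 1) ^ (-m)`, cancelling the
  -- number of cuts.
  set K := t * E + t ^ 2 * A ^ 2 / 4 * N + m * Real.log (2 * n + 1) with hK
  have hdep (l : List (ℕ × ℕ)) := dependsOn_cutScore w δ N 0 l
  have hexp (l : List (ℕ × ℕ)) :
      Integrable (fun ω => Real.exp (t * cutScore w δ N (fun k => ξ k ω) 0 l - K)) P :=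
    integrable_of_dependsOn hξ (DependsOn.comp_left (hdep l) fun v => Real.exp (t * v - K))
  have hone {l : List (ℕ × ℕ)} (hl : l ∈ incrementLists n m) :
      ∫ ω, Real.exp (t * cutScore w δ N (fun k => ξ k ω) 0 l - K) ∂P ≤
        ((2 * n + 1 : ℝ) ^ m)⁻¹ := by
    have h₁ := integral_exp_le_of_boundedDifferences (P := P) hξ hind (A := A) t _ (hdep l)
      (abs_cutScore_update_sub_le hA₁ hA₂ 0 l)
    have h₂ := integral_cutScore_le hw hwδ hξ hind hlaw N n m 0 hl
    set M := ∫ ω, cutScore w δ N (fun k => ξ k ω) 0 l ∂P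
    calc _ = ∫ ω, Real.exp (t * (cutScore w δ N (fun k => ξ k ω) 0 l - M)) *
            Real.exp (t * M - K) ∂P := by
          refine integral_congr_ae (ae_of_all _ fun ω => ?_)
          simp only [← Real.exp_add]
          congr 1
          ring
      _ = (∫ ω, Real.exp (t * (cutScore w δ N (fun k => ξ k ω) 0 l - M)) ∂P) *
            Real.exp (t * M - K) := integral_mul_const _ _
      _ ≤ Real.exp (t ^ 2 * A ^ 2 / 4 * N) * Real.exp (t * E - K) := by
          gcongr
          refine h₁.trans_eq ?_
          congr 1
          simp only [Prod.fst_zero, Prod.snd_zero, Finset.card_disjSum, Nat.card_Ico, Nat.sub_zero]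
          push_cast
          ring
      _ = Real.exp (-(m * Real.log (2 * n + 1))) := by
          rw [← Real.exp_add, hK]
          congr 1
          ring
      _ = _ := by
          rw [Real.exp_neg, mul_comm, Real.exp_mul, Real.exp_log (by positivity), Real.rpow_natCast]
  -- `x + 1 ≤ exp x` for the cut that suits `ω`, whose term is at most the whole sum; integrating
  -- gives the union bound without tail estimates.
  have hpt (ω : Ω) : t * gappedBoxScore w δ (fun k => ξ k ω) 0 N 0 N - K + 1 ≤
      ∑ l ∈ incrementLists n m, Real.exp (t * cutScore w δ N (fun k => ξ k ω) 0 l - K) := by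
    obtain ⟨l, hl, hle⟩ := exists_boxScore_le_cutScore w δ (fun k => ξ k ω) hn hm
    have hgap : gappedBoxScore w δ (fun k => ξ k ω) 0 N 0 N =
        boxScore w (fun k => ξ k ω) 0 N 0 N + δ * N := by
      simp only [gappedBoxScore, Nat.sub_zero]
      push_cast
      ring
    rw [hgap]
    refine (Real.add_one_le_exp _).trans ?_
    refine le_trans ?_ (Finset.single_le_sum (fun l _ => (Real.exp_pos _).le) hl)
    gcongr
  have hint := (integrable_gappedBoxScore (P := P) (w := w) (δ := δ) hξ 0 N 0 N).const_mul t
  have hmono := integral_mono (μ := P) ((hint.sub (integrable_const K)).add (integrable_const 1))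
    (integrable_finsetSum _ fun l _ => hexp l) hpt
  rw [integral_finsetSum _ fun l _ => hexp l] at hmono
  have hsum : ∑ l ∈ incrementLists n m,
      ∫ ω, Real.exp (t * cutScore w δ N (fun k => ξ k ω) 0 l - K) ∂P ≤ 1 := by
    refine (Finset.sum_le_card_nsmul _ _ _ fun l hl => hone hl).trans ?_
    rw [nsmul_eq_mul, ← div_eq_mul_inv]
    refine div_le_one_of_le₀ ?_ (by positivity)
    exact_mod_cast card_incrementLists_le hn m
  have hleft : ∫ ω, (t * gappedBoxScore w δ (fun k => ξ k ω) 0 N 0 N - K + 1) ∂P =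
      t * meanBoxScore P ξ w δ N N - K + 1 := by
    refine (integral_add (hint.sub (integrable_const K)) (integrable_const 1)).trans ?_
    refine congrArg₂ (· + ·) ((integral_sub hint (integrable_const K)).trans ?_) (by simp)
    rw [integral_const_mul]
    simp [meanBoxScore]
  have := hleft.symm.trans_le (hmono.trans hsum)
  linarith

/-- The exponential of the right side is `e * exp (2 / (n - 1)) * (n - 1)`, at least `2 * (1 + 2 /
(n - 1)) * (n - 1) = 2 * (n + 1)`. -/
theorem log_two_mul_add_one_le {n : ℕ} (hn : 2 ≤ n) :
    Real.log (2 * n + 1) ≤ ((n : ℝ) + 1) / ((n : ℝ) - 1) + Real.log ((n : ℝ) - 1) := by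
  have hn' : (2 : ℝ) ≤ n := by exact_mod_cast hn
  have hpos : (0 : ℝ) < n - 1 := by linarith
  rw [Real.log_le_iff_le_exp (by positivity), Real.exp_add, Real.exp_log hpos]
  have h₁ : ((n : ℝ) + 1) / (n - 1) = 1 + 2 / (n - 1) := by field_simp; ring
  have h₂ := Real.add_one_le_exp (2 / ((n : ℝ) - 1))
  have h₃ := Real.add_one_le_exp (1 : ℝ)
  rw [h₁, Real.exp_add]
  calc (2 * n + 1 : ℝ) ≤ (1 + 1) * (2 / ((n : ℝ) - 1) + 1) * (n - 1) := by
        field_simp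
        linarith
    _ ≤ _ := by gcongr

end MeanScores

/-! ### Fekete's limit and the choice of parameters -/

section MainTheorem

variable {𝔸 : Type*} [Fintype 𝔸] [Nonempty 𝔸]

theorem le_maxLetterScore (S : 𝔸 → 𝔸 → ℝ) (a b : 𝔸) : S a b ≤ maxLetterScore S :=
  Finset.le_sup' (fun p : 𝔸 × 𝔸 => S p.1 p.2) (Finset.mem_univ (a, b))

theorem abs_sub_le_maxScoreChange (S : 𝔸 → 𝔸 → ℝ) (a b c : 𝔸) :
    |S a b - S a c| ≤ maxScoreChange S :=
  Finset.le_sup' (fun p : 𝔸 × 𝔸 × 𝔸 => |S p.1 p.2.1 - S p.1 p.2.2|) (Finset.mem_univ (a, b, c))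

theorem optimalScore_le {S : 𝔸 → 𝔸 → ℝ} {δ : ℝ} (hδ : δ ≤ maxLetterScore S) {n : ℕ}
    (x y : Fin n → 𝔸) : optimalScore S δ x y ≤ maxLetterScore S * n := by
  refine ciSup_le fun α => ?_
  have hk : (α.k : ℝ) ≤ n := by exact_mod_cast α.k_le
  have h₁ : ∑ i : Fin α.k, S (x (α.fst i)) (y (α.snd i)) ≤ α.k * maxLetterScore S := by
    simpa using Finset.sum_le_card_nsmul Finset.univ
      (fun i : Fin α.k => S (x (α.fst i)) (y (α.snd i))) _ fun i _ => le_maxLetterScore S _ _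
  have h₂ : δ * ((n : ℝ) - α.k) ≤ maxLetterScore S * (n - α.k) :=
    mul_le_mul_of_nonneg_right hδ (by linarith)
  rw [alignmentScore]
  linarith

end MainTheorem

end SequenceComparison

end

theorem theorem1 {𝔸 : Type*} [Fintype 𝔸] [Nonempty 𝔸] [MeasurableSpace 𝔸]
    [MeasurableSingletonClass 𝔸] {Ω : Type*} [MeasurableSpace Ω] (P : Measure Ω)
    [IsProbabilityMeasure P] (S : 𝔸 → 𝔸 → ℝ) (hS_nonneg : ∀ a b, 0 ≤ S a b)
    (hS_symm : ∀ a b, S a b = S b a) (δ : ℝ) (hδ : δ ≤ SequenceComparison.maxLetterScore S)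
    (X Y : ℕ → Ω → 𝔸) (hX : ∀ i, Measurable (X i)) (hY : ∀ i, Measurable (Y i))
    (hindep : iIndepFun (Sum.elim X Y) P)
    (hX_ident : ∀ i, IdentDistrib (X i) (X 0) P P)
    (hY_ident : ∀ i, IdentDistrib (Y i) (X 0) P P) :
    ∃ l : ℝ, Tendsto (SequenceComparison.meanScore P S δ X Y) atTop (𝓝 l) ∧
      ∀ n : ℕ, 0 < n → Even n → ∀ c : ℝ, SequenceComparison.maxScoreChange S < c →
        l - SequenceComparison.meanScore P S δ X Y n ≤
          c * √((2 / ((n : ℝ) - 1)) *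
              (((n : ℝ) + 1) / ((n : ℝ) - 1) + Real.log ((n : ℝ) - 1))) +
            SequenceComparison.maxLetterScore S / ((n : ℝ) - 1) := by
  open SequenceComparison in
  let ξ : ℕ ⊕ ℕ → Ω → 𝔸 := Sum.elim X Y
  have hξ : ∀ i, Measurable (ξ i) := by rintro (i | i) <;> simp [ξ, hX, hY]
  have hlaw : ∀ i, P.map (ξ i) = P.map (X 0) := by
    rintro (i | i)
    · exact (hX_ident i).map_eq
    · exact (hY_ident i).map_eq
  let w : 𝔸 → 𝔸 → ℝ := fun x y => S x y - δ
  have hw : ∀ x y, w x y = w y x := fun x y => by simp only [w, hS_symm x y]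
  have hwδ : ∀ x y, 0 ≤ w x y + δ := fun x y => by simpa [w] using hS_nonneg x y
  have hA₂ : ∀ x y y', |w x y - w x y'| ≤ maxScoreChange S := fun x y y' => by
    simpa [w] using abs_sub_le_maxScoreChange S x y y'
  have hA₁ : ∀ x x' y, |w x y - w x' y| ≤ maxScoreChange S := fun x x' y => by
    rw [hw x y, hw x' y]
    exact hA₂ y x x'
  let u : ℕ → ℝ := fun n => meanBoxScore P ξ w δ n n
  have hopt (n : ℕ) (ω : Ω) : optimalScore S δ (fun i : Fin n => X i ω) (fun i : Fin n => Y i ω) =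
      gappedBoxScore w δ (fun k => ξ k ω) 0 n 0 n := by
    refine (optimalScore_eq_boxScore S δ (fun k => ξ k ω) n).trans ?_
    simp only [gappedBoxScore, Nat.sub_zero]
    push_cast
    ring
  have hmean : meanScore P S δ X Y = fun n => u n / n := by
    funext n
    simp only [meanScore, hopt]
    rfl
  have hF0 : 0 ≤ maxLetterScore S := by
    obtain ⟨a⟩ := ‹Nonempty 𝔸›
    exact (hS_nonneg a a).trans (le_maxLetterScore S a a)
  have huF (n : ℕ) : u n ≤ maxLetterScore S * n := by
    refine (integral_mono (integrable_gappedBoxScore hξ 0 n 0 n) (integrable_const _)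
      fun ω => ?_).trans_eq (integral_const (μ := P) (maxLetterScore S * n) |>.trans (by simp))
    rw [← hopt]
    exact optimalScore_le hδ _ _
  have hsub : Subadditive fun n => - u n := fun a b => by
    have := meanBoxScore_add_le (w := w) (δ := δ) hξ hindep hlaw a a b b
    simp only [u]
    linarith
  have hbdd : BddBelow (Set.range fun n : ℕ => -u n / n) := by
    refine ⟨-maxLetterScore S, ?_⟩
    rintro _ ⟨n, rfl⟩
    rcases Nat.eq_zero_or_pos n with rfl | hn
    · simpa using hF0
    · have hn' : (0 : ℝ) < n := by exact_mod_cast hn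
      simp only
      rw [le_div_iff₀ hn']
      linarith [huF n]
  have hlim : Tendsto (fun n : ℕ => u n / n) atTop (𝓝 (-hsub.lim)) := by
    have := (hsub.tendsto_lim hbdd).neg
    simpa [neg_div] using this
  rw [hmean]
  refine ⟨-hsub.lim, hlim, fun n hn heven c hc => ?_⟩
  -- Evenness excludes `n = 1`, where the denominator `n - 1` vanishes.
  have hn2 : 2 ≤ n := by
    obtain ⟨k, rfl⟩ := heven
    omega
  have hn' : (2 : ℝ) ≤ n := by exact_mod_cast hn2
  have hpos : (0 : ℝ) < n - 1 := by linarith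
  have hA0 : 0 ≤ maxScoreChange S := by
    obtain ⟨a⟩ := ‹Nonempty 𝔸›
    exact (abs_nonneg _).trans (abs_sub_le_maxScoreChange S a a a)
  -- The strict inequality `A < c` allows division by `c` even if `A = 0`.
  have hc0 : 0 < c := hA0.trans_lt hc
  set R := ((n : ℝ) + 1) / ((n : ℝ) - 1) + Real.log ((n : ℝ) - 1) with hR
  have hlogR : Real.log (2 * n + 1) ≤ R := log_two_mul_add_one_le hn2
  have hRpos : 0 < R := (Real.log_pos (by linarith)).trans_le hlogR
  set B := √(2 / ((n : ℝ) - 1) * R) with hB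
  have hBpos : 0 < B := Real.sqrt_pos.2 (by positivity)
  have hBsq : B ^ 2 = 2 / ((n : ℝ) - 1) * R := Real.sq_sqrt (by positivity)
  have hkey (q : ℕ) (hq : 0 < q) :
      u (q * (n - 1)) / ((q * (n - 1) : ℕ) : ℝ) ≤ u n / (n - 1) + c * B := by
    have hq' : (0 : ℝ) < q := by exact_mod_cast hq
    have hN : ((q * (n - 1) : ℕ) : ℝ) = q * (n - 1) := by
      push_cast [Nat.cast_sub (by omega : 1 ≤ n)]
      ring
    -- With `t = 2 * B / c`, the variance and entropy terms are each at most `B ^ 2 * N`; divided by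
    -- `t * N` they contribute `c * B / 2` each.
    have h := mul_meanBoxScore_le hA₁ hA₂ hw hwδ hξ hindep hlaw (N := q * (n - 1)) (n := n)
      (m := 2 * q) (by omega) (by rw [mul_assoc]) (t := 2 * B / c) (by positivity)
    rw [hN] at h ⊢
    push_cast at h
    have hA : maxScoreChange S ^ 2 ≤ c ^ 2 := by gcongr
    have h₁ : (2 * B / c) ^ 2 * maxScoreChange S ^ 2 / 4 * (q * (n - 1)) ≤
        B ^ 2 * (q * (n - 1)) := by
      calc _ ≤ (2 * B / c) ^ 2 * c ^ 2 / 4 * (q * (n - 1)) := by gcongr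
        _ = _ := by field_simp; ring
    have h₂ : 2 * (q : ℝ) * Real.log (2 * n + 1) ≤ B ^ 2 * (q * (n - 1)) := by
      calc _ ≤ 2 * (q : ℝ) * R := by gcongr
        _ = _ := by rw [hBsq]; field_simp
    have h₃ : 2 * B / c * u (q * (n - 1)) ≤
        2 * B / c * ((u n / (n - 1) + c * B) * (q * (n - 1))) := by
      refine (h.trans (add_le_add (add_le_add le_rfl h₁) h₂)).trans_eq ?_
      simp only [u]
      field_simp
      ring
    rw [div_le_iff₀ (by positivity)]
    exact le_of_mul_le_mul_left h₃ (by positivity)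
  have hsubseq : Tendsto (fun q : ℕ => q * (n - 1)) atTop atTop :=
    tendsto_id.atTop_mul_const' (by omega)
  have hle : -hsub.lim ≤ u n / (n - 1) + c * B :=
    le_of_tendsto (hlim.comp hsubseq) (eventually_atTop.2 ⟨1, fun q hq => hkey q hq⟩)
  have hsplit : u n / ((n : ℝ) - 1) ≤ u n / n + maxLetterScore S / (n - 1) := by
    have h := huF n
    rw [← sub_le_iff_le_add']
    have : u n / ((n : ℝ) - 1) - u n / n = u n / n / (n - 1) := by
      field_simp
      ring
    rw [this]
    gcongr
    rwa [div_le_iff₀ (by linarith)]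
  linarith
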